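/- Let $A\in\mathbb{R}^{n\times m}$ be a nonzero matrix with columns $a_1,\dots,a_m$ and singular values $\sigma_i(A)$, and let $$\mathrm{srank}_4(A)=\frac{\big(\sum_i\sigma_i(A)^2\big)^2}{\sum_i\sigma_i(A)^4}.$$ Let $\tilde A$ denote the matrix $A$ with normalized columns, that is, every nonzero column $a_j$ is replaced by $a_j/\|a_j\|_2$ (zero columns, if there are any, are left unchanged). For a subset $\mathcal S\subseteq\{1,\dots,m\}$ let $\tilde A_{\mathcal S}$ be the submatrix of $\tilde A$ formed by the columns indexed by $\mathcal S$, and let $\sigma_{\min}(M)=\min_{\|x\|_2=1}\|Mx\|_2$ denote the least singular value of a matrix $M$. Then for every $\epsilon\in(0,1)$ there exists a subset $\mathcal S\subseteq\{1,\dots,m\}$ of size $$k=\big\lfloor(1-\epsilon)^2\,\mathrm{srank}_4(A)\big\rfloor+1$$ such that $$\sigma_{\min}(\tilde A_{\mathcal S})\ge\epsilon.$$ In particular this holds with $k=(1-\epsilon)^2\,\mathrm{srank}_4(A)+1$ whenever that number is an integer. -/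

import Mathlib

noncomputable section

/-- The Schatten `4`-norm stable rank `(∑ σᵢ(A)²)² / ∑ σᵢ(A)⁴` of a real `n × m` matrix. The
singular values are Mathlib's: zero-indexed, decreasing, and zero from the index `m` on, so that
both sums run over all nonzero singular values. -/
def srankFour {n m : ℕ} (A : Matrix (Fin n) (Fin m) ℝ) : ℝ :=
  (∑ i ∈ Finset.range m, A.toEuclideanLin.singularValues i ^ 2) ^ 2 /
    ∑ i ∈ Finset.range m, A.toEuclideanLin.singularValues i ^ 4

/-- The least singular value `min_{‖x‖₂ = 1} ‖M x‖₂` of a real matrix. For a nonempty set `κ` of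
column indices the unit sphere is compact and nonempty, and the infimum is a minimum. -/
def sigmaMin {n : ℕ} {κ : Type*} [Fintype κ] [DecidableEq κ] (M : Matrix (Fin n) κ ℝ) : ℝ :=
  ⨅ x : Metric.sphere (0 : EuclideanSpace ℝ κ) 1, ‖M.toEuclideanLin (x : EuclideanSpace ℝ κ)‖

/-- The matrix `A` with normalized columns: the `j`-th column `a_j` is replaced by
`a_j / ‖a_j‖₂`; a zero column stays zero. -/
def normalizeCols {n m : ℕ} (A : Matrix (Fin n) (Fin m) ℝ) : Matrix (Fin n) (Fin m) ℝ :=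
  Matrix.of fun i j => A i j / ‖WithLp.toLp 2 (A.col j)‖

/-- The submatrix of `A` formed by the columns with index in `S`. -/
def colsSubmatrix {n m : ℕ} (A : Matrix (Fin n) (Fin m) ℝ) (S : Finset (Fin m)) :
    Matrix (Fin n) S ℝ :=
  A.submatrix id Subtype.val

end

/-
Draw `k` indices independently, index `j` with probability `‖aⱼ‖² / ‖A‖²` (Frobenius norm). Since
the normalized columns satisfy `𝔼 ãⱼ ãⱼᵀ = A Aᵀ / ‖A‖²`, the expected characteristic polynomial of
their `k × k` Gram matrix is `∏ᵢ (1 - μᵢ D) xᵏ`, where `D = d/dx` and `μᵢ = σᵢ(A)² / ‖A‖²`.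

Each factor `1 - μ D` keeps a polynomial real-rooted and moves a lower barrier for its roots, that
is a point `b` with `∑ 1 / (rᵢ - b) ≤ φ`, to the right by `μ / (1 + μ φ)`. Starting at `-k / φ` and
optimizing in `φ`, this puts all roots above `ε²` as soon as `(k - 1) ∑ μᵢ² ≤ (1 - ε)²`, that is
`k - 1 ≤ (1 - ε)² srank₄(A)`.

Fix the indices one at a time. In the upper half-plane, the quotient of the conditional expectations
after and before a draw has imaginary part of constant sign, by stability of the determinants
`det (K - diag z)` in `z`. Hence it is monotone between poles on the real line, so that some choice
of the next index keeps all roots above `ε²`. For the final choice the Gram matrix itself has all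
its eigenvalues above `ε²`; in particular it is nonsingular, and no index has been chosen twice.
-/

open Polynomial Matrix

section ExpectedMinor

variable {ι R : Type*} [Fintype ι] [CommRing R]

/-- The expectation of `det (K.submatrix g g - diagonal y)`, where `g` extends `f` by `l` further
indices drawn independently with probabilities `w`, and `y` extends `z` by the constant `x`. Keeping
the diagonal entries `z` of the indices already chosen as separate variables is what makes real
stability usable. -/
def expectedMinor (K : Matrix ι ι R) (w : ι → R) (x : R) :
    ℕ → {r : ℕ} → (Fin r → ι) → (Fin r → R) → R
  | 0, _, f, z => (K.submatrix f f - diagonal z).det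
  | l + 1, _, f, z => ∑ i, w i * expectedMinor K w x l (Fin.cons i f) (Fin.cons x z)

theorem map_expectedMinor {S : Type*} [CommRing S] (φ : R →+* S) (K : Matrix ι ι R) (w : ι → R)
    (x : R) (l : ℕ) {r : ℕ} (f : Fin r → ι) (z : Fin r → R) :
    φ (expectedMinor K w x l f z) = expectedMinor (K.map φ) (φ ∘ w) (φ x) l f (φ ∘ z) := by
  induction l generalizing r with
  | zero =>
    rw [expectedMinor, expectedMinor, RingHom.map_det, map_sub, RingHom.mapMatrix_apply,
      RingHom.mapMatrix_apply, submatrix_map, diagonal_map (map_zero φ)]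
    rfl
  | succ l ih =>
    simp only [expectedMinor, map_sum, map_mul, ih, Function.comp_apply, Fin.comp_cons]

theorem det_sub_diagonal_insertNth_add {r : ℕ} (M : Matrix (Fin (r + 1)) (Fin (r + 1)) R)
    (p : Fin (r + 1)) (y s : R) (z : Fin r → R) :
    (M - diagonal (p.insertNth (y + s) z)).det = (M - diagonal (p.insertNth y z)).det
      - s * (M.submatrix p.succAbove p.succAbove - diagonal z).det := by
  set N := M - diagonal (p.insertNth y z) with hN
  have hrow : M - diagonal (p.insertNth (y + s) z)
      = N.updateRow p (N p + (-s) • Pi.single p 1) := by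
    ext a b
    cases a using p.succAboveCases <;> cases b using p.succAboveCases <;>
      simp [hN, diagonal_apply]
    ring
  have hminor : (N.updateRow p (Pi.single p 1)).det
      = (M.submatrix p.succAbove p.succAbove - diagonal z).det := by
    rw [← adjugate_apply, adjugate_fin_succ_eq_det_submatrix, Even.neg_one_pow ⟨_, rfl⟩, one_mul]
    congr 1
    ext a b
    simp [hN, diagonal_apply]
  rw [hrow, det_updateRow_add, det_updateRow_smul, updateRow_eq_self, hminor]
  ring

theorem expectedMinor_insertNth_add (K : Matrix ι ι R) (w : ι → R) (x : R) (l : ℕ) {r : ℕ}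
    (p : Fin (r + 1)) (i : ι) (f : Fin r → ι) (y s : R) (z : Fin r → R) :
    expectedMinor K w x l (p.insertNth i f) (p.insertNth (y + s) z)
      = expectedMinor K w x l (p.insertNth i f) (p.insertNth y z)
        - s * expectedMinor K w x l f z := by
  induction l generalizing r with
  | zero =>
    simp only [expectedMinor, det_sub_diagonal_insertNth_add, submatrix_submatrix,
      Fin.insertNth_comp_succAbove]
  | succ l ih =>
    simp only [expectedMinor, ← Fin.insertNth_succ_cons, ih, mul_sub, Finset.sum_sub_distrib,
      Finset.mul_sum, mul_left_comm]

theorem expectedMinor_cons_add (K : Matrix ι ι R) (w : ι → R) (x : R) (l : ℕ) {r : ℕ}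
    (i : ι) (f : Fin r → ι) (y s : R) (z : Fin r → R) :
    expectedMinor K w x l (Fin.cons i f : Fin (r + 1) → ι) (Fin.cons (y + s) z)
      = expectedMinor K w x l (Fin.cons i f : Fin (r + 1) → ι) (Fin.cons y z)
        - s * expectedMinor K w x l f z := by
  simpa only [Fin.insertNth_zero'] using expectedMinor_insertNth_add K w x l 0 i f y s z

end ExpectedMinor

section Stability

variable {ι : Type*} [Fintype ι]

theorem det_sub_diagonal_ne_zero_of_im_pos {κ : Type*} [Fintype κ] [DecidableEq κ]
    {H : Matrix κ κ ℂ} (hH : H.IsHermitian) {z : κ → ℂ} (hz : ∀ j, 0 < (z j).im) :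
    (H - diagonal z).det ≠ 0 := by
  intro hdet
  obtain ⟨x, hx, hker⟩ := exists_mulVec_eq_zero_iff.2 hdet
  have hquad : (star x ⬝ᵥ diagonal z *ᵥ x).im = ∑ j, Complex.normSq (x j) * (z j).im := by
    simp only [dotProduct, mulVec_diagonal, Complex.im_sum, Pi.star_apply, Complex.star_def]
    refine Finset.sum_congr rfl fun j _ => ?_
    rw [mul_left_comm, ← Complex.normSq_eq_conj_mul_self, Complex.im_mul_ofReal, mul_comm]
  have hzero : star x ⬝ᵥ H *ᵥ x = star x ⬝ᵥ diagonal z *ᵥ x := by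
    rw [sub_mulVec, sub_eq_zero] at hker
    rw [hker]
  have him : (star x ⬝ᵥ H *ᵥ x).im = 0 := hH.im_star_dotProduct_mulVec_self x
  obtain ⟨j, hj⟩ := Function.ne_iff.1 hx
  have hpos : 0 < ∑ j, Complex.normSq (x j) * (z j).im :=
    Finset.sum_pos' (fun i _ => mul_nonneg (Complex.normSq_nonneg _) (hz i).le)
      ⟨j, Finset.mem_univ j, mul_pos (Complex.normSq_pos.2 hj) (hz j)⟩
  linarith [congrArg Complex.im hzero]

theorem im_expectedMinor_cons_div_neg {K : Matrix ι ι ℂ} {w : ι → ℂ} {x : ℂ} {l : ℕ}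
    (hne : ∀ {r : ℕ} (f : Fin r → ι) (z : Fin r → ℂ), (∀ j, 0 < (z j).im) →
      expectedMinor K w x l f z ≠ 0)
    {r : ℕ} (i : ι) (f : Fin r → ι) {y : ℂ} (hy : 0 < y.im) {z : Fin r → ℂ}
    (hz : ∀ j, 0 < (z j).im) :
    (expectedMinor K w x l (Fin.cons i f : Fin (r + 1) → ι) (Fin.cons y z)
      / expectedMinor K w x l f z).im < 0 := by
  by_contra! hq
  -- Shifting `y` by the quotient `q` stays in the upper half-plane and hits a zero.
  set q := expectedMinor K w x l (Fin.cons i f : Fin (r + 1) → ι) (Fin.cons y z)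
      / expectedMinor K w x l f z with hqdef
  have hzero : expectedMinor K w x l (Fin.cons i f : Fin (r + 1) → ι) (Fin.cons (y + q) z) = 0 := by
    rw [expectedMinor_cons_add, hqdef, div_mul_cancel₀ _ (hne f z hz), sub_self]
  exact hne _ _ (Fin.cases (by simpa using add_pos_of_pos_of_nonneg hy hq) hz) hzero

theorem im_expectedMinor_succ_div_neg {K : Matrix ι ι ℂ} {w : ι → ℝ} (hw : ∀ i, 0 ≤ w i)
    (hw1 : ∑ i, w i = 1) {x : ℂ} (hx : 0 < x.im) {l : ℕ}
    (hne : ∀ {r : ℕ} (f : Fin r → ι) (z : Fin r → ℂ), (∀ j, 0 < (z j).im) →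
      expectedMinor K (fun i => (w i : ℂ)) x l f z ≠ 0)
    {r : ℕ} (f : Fin r → ι) {z : Fin r → ℂ} (hz : ∀ j, 0 < (z j).im) :
    (expectedMinor K (fun i => (w i : ℂ)) x (l + 1) f z
      / expectedMinor K (fun i => (w i : ℂ)) x l f z).im < 0 := by
  have hneg i := im_expectedMinor_cons_div_neg hne i f hx hz
  obtain ⟨i₀, -, hi₀⟩ := Finset.exists_ne_zero_of_sum_ne_zero (hw1.trans_ne one_ne_zero)
  simp only [expectedMinor, Finset.sum_div, Complex.im_sum, mul_div_assoc, Complex.im_ofReal_mul]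
  exact Finset.sum_neg' (fun i _ => mul_nonpos_of_nonneg_of_nonpos (hw i) (hneg i).le)
    ⟨i₀, Finset.mem_univ _, mul_neg_of_pos_of_neg ((hw i₀).lt_of_ne' hi₀) (hneg i₀)⟩

theorem expectedMinor_ne_zero {K : Matrix ι ι ℂ} (hK : K.IsHermitian) {w : ι → ℝ}
    (hw : ∀ i, 0 ≤ w i) (hw1 : ∑ i, w i = 1) {x : ℂ} (hx : 0 < x.im) (l : ℕ) {r : ℕ}
    (f : Fin r → ι) (z : Fin r → ℂ) (hz : ∀ j, 0 < (z j).im) :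
    expectedMinor K (fun i => (w i : ℂ)) x l f z ≠ 0 := by
  induction l generalizing r with
  | zero => exact det_sub_diagonal_ne_zero_of_im_pos (hK.submatrix f) hz
  | succ l ih =>
    intro h0
    have hneg := im_expectedMinor_succ_div_neg hw hw1 hx ih f hz
    simp only [h0, zero_div, Complex.zero_im, lt_self_iff_false] at hneg

end Stability

section RealRooted

theorem re_nonpos_of_hasDerivAt_of_im_nonpos {q : ℂ → ℂ} {q' : ℂ} {x : ℝ}
    (hq : HasDerivAt q q' x) (hx : (q x).im = 0) (him : ∀ z : ℂ, 0 < z.im → (q z).im ≤ 0) :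
    q'.re ≤ 0 := by
  have hline : HasDerivAt (fun y : ℝ => (x : ℂ) + y * Complex.I) Complex.I 0 := by
    simpa using ((hasDerivAt_id (0 : ℝ)).ofReal_comp.mul_const Complex.I).const_add (x : ℂ)
  have hcomp : HasDerivAt (fun y : ℝ => (q (x + y * Complex.I)).im) q'.re 0 := by
    have hq0 : HasDerivAt q q' (x + (0 : ℝ) * Complex.I) := by simpa using hq
    simpa [Function.comp_def] using!
      Complex.imCLM.hasFDerivAt.comp_hasDerivAt (0 : ℝ) (hq0.comp (0 : ℝ) hline)
  refine le_of_tendsto hcomp.tendsto_slope_zero_right ?_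
  filter_upwards [self_mem_nhdsWithin] with y (hy : 0 < y)
  have hnonpos : (q (x + y * Complex.I)).im ≤ 0 := him _ (by simpa using hy)
  simpa [hx] using mul_nonpos_of_nonneg_of_nonpos (inv_nonneg.2 hy.le) hnonpos

theorem antitoneOn_eval_div_of_im_nonpos {p f : ℝ[X]} {s : Set ℝ} (hs : Convex ℝ s)
    (hf : ∀ x ∈ s, f.eval x ≠ 0)
    (him : ∀ z : ℂ, 0 < z.im → (aeval z p / aeval z f).im ≤ 0) :
    AntitoneOn (fun x => p.eval x / f.eval x) s := by
  have hderiv x (hx : x ∈ s) := (p.hasDerivAt x).fun_div (f.hasDerivAt x) (hf x hx)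
  have aeval_ofReal (g : ℝ[X]) (x : ℝ) : aeval (x : ℂ) g = ((g.eval x : ℝ) : ℂ) :=
    aeval_algebraMap_apply_eq_algebraMap_eval x g
  refine antitoneOn_of_deriv_nonpos hs
    (fun x hx => (hderiv x hx).continuousAt.continuousWithinAt)
    (fun x hx => (hderiv x (interior_subset hx)).differentiableAt.differentiableWithinAt)
    fun x hx => ?_
  replace hx := interior_subset hx
  have hcomplex := (p.hasDerivAt_aeval (x : ℂ)).div (f.hasDerivAt_aeval (x : ℂ))
    (by simpa [aeval_ofReal] using hf x hx)
  rw [(hderiv x hx).deriv]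
  have hre := re_nonpos_of_hasDerivAt_of_im_nonpos hcomplex
    (by simp only [Pi.div_apply, aeval_ofReal, ← Complex.ofReal_div, Complex.ofReal_im]) him
  simp only [aeval_ofReal] at hre
  exact_mod_cast hre

end RealRooted

section ExpectedMinorPoly

variable {ι : Type*} [Fintype ι]

theorem cons_const_self {α : Type*} (n : ℕ) (x : α) :
    (Fin.cons x fun _ : Fin n => x : Fin (n + 1) → α) = fun _ => x :=
  vecCons_const x

/-- The expected characteristic polynomial, up to sign, of the random principal submatrix of `K` on
the indices `f` and `l` further ones drawn independently with probabilities `w`: the expectation of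
`det (K.submatrix g g - X)`, where `g` extends `f`. -/
noncomputable def expectedMinorPoly (K : Matrix ι ι ℝ) (w : ι → ℝ) (l : ℕ) {r : ℕ}
    (f : Fin r → ι) : ℝ[X] :=
  expectedMinor (K.map C) (fun i => C (w i)) X l f fun _ => X

theorem expectedMinorPoly_succ (K : Matrix ι ι ℝ) (w : ι → ℝ) (l : ℕ) {r : ℕ} (f : Fin r → ι) :
    expectedMinorPoly K w (l + 1) f
      = ∑ i, C (w i) * expectedMinorPoly K w l (Fin.cons i f : Fin (r + 1) → ι) := by
  simp only [expectedMinorPoly, expectedMinor, cons_const_self]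

theorem eval_expectedMinorPoly (K : Matrix ι ι ℝ) (w : ι → ℝ) (l : ℕ) {r : ℕ} (f : Fin r → ι)
    (x : ℝ) : (expectedMinorPoly K w l f).eval x = expectedMinor K w x l f fun _ => x := by
  have hK : (K.map C).map (evalRingHom x) = K := by ext; simp
  rw [expectedMinorPoly, ← coe_evalRingHom, map_expectedMinor, hK]
  simp [Function.comp_def]

theorem aeval_expectedMinorPoly (K : Matrix ι ι ℝ) (w : ι → ℝ) (l : ℕ) {r : ℕ} (f : Fin r → ι)
    (z : ℂ) : aeval z (expectedMinorPoly K w l f)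
      = expectedMinor (K.map (↑)) (fun i => (w i : ℂ)) z l f fun _ => z := by
  rw [expectedMinorPoly, ← AlgHom.coe_toRingHom, map_expectedMinor]
  simp [Function.comp_def, Matrix.map_map]

theorem expectedMinor_pos {K : Matrix ι ι ℝ} (hK : K.PosSemidef) {w : ι → ℝ}
    (hw : ∀ i, 0 ≤ w i) (hw1 : ∑ i, w i = 1) {x : ℝ} (hx : x < 0) (l : ℕ) {r : ℕ}
    (f : Fin r → ι) {z : Fin r → ℝ} (hz : ∀ j, z j < 0) : 0 < expectedMinor K w x l f z := by
  induction l generalizing r with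
  | zero =>
    have hpd : (K.submatrix f f + diagonal fun j => -z j).PosDef :=
      (PosDef.diagonal fun j => neg_pos.2 (hz j)).posSemidef_add (hK.submatrix f)
    simpa [expectedMinor, sub_eq_add_neg, diagonal_neg] using hpd.det_pos
  | succ l ih =>
    have hpos i : 0 < expectedMinor K w x l (Fin.cons i f : Fin (r + 1) → ι) (Fin.cons x z) :=
      ih _ (Fin.cases hx hz)
    obtain ⟨i₀, -, hi₀⟩ := Finset.exists_ne_zero_of_sum_ne_zero (hw1.trans_ne one_ne_zero)
    exact Finset.sum_pos' (fun i _ => mul_nonneg (hw i) (hpos i).le)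
      ⟨i₀, Finset.mem_univ _, mul_pos ((hw i₀).lt_of_ne' hi₀) (hpos i₀)⟩

variable {K : Matrix ι ι ℝ} {w : ι → ℝ}

theorem im_aeval_expectedMinorPoly_cons_div_neg (hK : K.IsHermitian)
    (hw : ∀ i, 0 ≤ w i) (hw1 : ∑ i, w i = 1) (l : ℕ) {r : ℕ} (i : ι) (f : Fin r → ι) {z : ℂ}
    (hz : 0 < z.im) :
    (aeval z (expectedMinorPoly K w l (Fin.cons i f : Fin (r + 1) → ι))
      / aeval z (expectedMinorPoly K w l f)).im < 0 := by
  have hne {r : ℕ} := expectedMinor_ne_zero (r := r)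
    (hK.map _ fun x => (Complex.conj_ofReal x).symm) hw hw1 hz l
  simpa only [aeval_expectedMinorPoly, cons_const_self] using
    im_expectedMinor_cons_div_neg hne i f hz (fun _ => hz)

theorem im_aeval_expectedMinorPoly_succ_div_neg (hK : K.IsHermitian)
    (hw : ∀ i, 0 ≤ w i) (hw1 : ∑ i, w i = 1) (l : ℕ) {r : ℕ} (f : Fin r → ι) {z : ℂ}
    (hz : 0 < z.im) :
    (aeval z (expectedMinorPoly K w (l + 1) f) / aeval z (expectedMinorPoly K w l f)).im < 0 := by
  have hne {r : ℕ} := expectedMinor_ne_zero (r := r)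
    (hK.map _ fun x => (Complex.conj_ofReal x).symm) hw hw1 hz l
  simpa only [aeval_expectedMinorPoly] using
    im_expectedMinor_succ_div_neg hw hw1 hz hne f (fun _ => hz)

theorem eval_expectedMinorPoly_pos_of_succ (hK : K.PosSemidef) (hw : ∀ i, 0 ≤ w i)
    (hw1 : ∑ i, w i = 1) {l : ℕ} {b : ℝ} {r : ℕ} {f : Fin r → ι}
    (hpos : ∀ x ≤ b, 0 < (expectedMinorPoly K w (l + 1) f).eval x) :
    ∀ x ≤ b, 0 < (expectedMinorPoly K w l f).eval x := by
  intro x hx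
  have hanti : AntitoneOn (fun x => (-expectedMinorPoly K w l f).eval x
      / (expectedMinorPoly K w (l + 1) f).eval x) (Set.Iic b) := by
    refine antitoneOn_eval_div_of_im_nonpos (convex_Iic b) (fun y hy => (hpos y hy).ne')
      fun z hz => ?_
    rw [map_neg, neg_div, Complex.neg_im, ← inv_div, Complex.inv_im, neg_div, neg_neg]
    exact div_nonpos_of_nonpos_of_nonneg
      (im_aeval_expectedMinorPoly_succ_div_neg hK.isHermitian hw hw1 l f hz).le
      (Complex.normSq_nonneg _)
  obtain ⟨y, hy⟩ := exists_lt (min x 0)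
  obtain ⟨hyx, hy0⟩ := lt_min_iff.1 hy
  have hfy : 0 < (expectedMinorPoly K w l f).eval y := by
    rw [eval_expectedMinorPoly]
    exact expectedMinor_pos hK hw hw1 hy0 l f fun _ => hy0
  have hle := hanti (hyx.le.trans hx) hx hyx.le
  simp only [eval_neg, neg_div, neg_le_neg_iff] at hle
  exact (div_pos_iff_of_pos_right (hpos x hx)).1
    ((div_pos hfy (hpos y (hyx.le.trans hx))).trans_le hle)

theorem exists_forall_eval_expectedMinorPoly_cons_pos (hK : K.PosSemidef) (hw : ∀ i, 0 ≤ w i)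
    (hw1 : ∑ i, w i = 1) {l : ℕ} {b : ℝ} {r : ℕ} {f : Fin r → ι}
    (hpos : ∀ x ≤ b, 0 < (expectedMinorPoly K w (l + 1) f).eval x) :
    ∃ i, ∀ x ≤ b, 0 < (expectedMinorPoly K w l (Fin.cons i f : Fin (r + 1) → ι)).eval x := by
  have hf := eval_expectedMinorPoly_pos_of_succ hK hw hw1 hpos
  obtain ⟨i, hi⟩ : ∃ i,
      0 < (expectedMinorPoly K w l (Fin.cons i f : Fin (r + 1) → ι)).eval b := by
    by_contra! hnonpos
    have hb := hpos b le_rfl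
    rw [expectedMinorPoly_succ, eval_finsetSum] at hb
    refine hb.not_ge (Finset.sum_nonpos fun i _ => ?_)
    rw [eval_mul, eval_C]
    exact mul_nonpos_of_nonneg_of_nonpos (hw i) (hnonpos i)
  have hanti := antitoneOn_eval_div_of_im_nonpos (convex_Iic b) (fun y hy => (hf y hy).ne')
    fun z hz => (im_aeval_expectedMinorPoly_cons_div_neg hK.isHermitian hw hw1 l i f hz).le
  refine ⟨i, fun x hx => (div_pos_iff_of_pos_right (hf x hx)).1 ?_⟩
  exact (div_pos hi (hf b le_rfl)).trans_le (hanti hx Set.self_mem_Iic hx)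

theorem exists_forall_det_submatrix_sub_pos (hK : K.PosSemidef) (hw : ∀ i, 0 ≤ w i)
    (hw1 : ∑ i, w i = 1) {b : ℝ} {k l r : ℕ} (hk : k = l + r) {f : Fin r → ι}
    (hpos : ∀ x ≤ b, 0 < (expectedMinorPoly K w l f).eval x) :
    ∃ g : Fin k → ι, ∀ x ≤ b, 0 < (K.submatrix g g - diagonal fun _ => x).det := by
  induction l generalizing r with
  | zero =>
    obtain rfl : k = r := by lia
    exact ⟨f, fun x hx => (hpos x hx).trans_eq (eval_expectedMinorPoly K w 0 f x)⟩
  | succ l ih =>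
    obtain ⟨i, hi⟩ := exists_forall_eval_expectedMinorPoly_cons_pos hK hw hw1 hpos
    exact ih (by lia) hi

end ExpectedMinorPoly

section PrincipalMinor

variable {ι R : Type*} [CommRing R]

theorem injective_of_det_submatrix_ne_zero (A : Matrix ι ι R) {k : ℕ} {g : Fin k → ι}
    (h : (A.submatrix g g).det ≠ 0) : g.Injective := by
  contrapose! h
  obtain ⟨a, b, hab, hne⟩ := Function.not_injective_iff.1 h
  exact det_zero_of_row_eq hne (by ext; simp [hab])

theorem det_submatrix_of_injective [DecidableEq ι] (A : Matrix ι ι R) {k : ℕ} {g : Fin k → ι}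
    (hg : g.Injective) :
    (A.submatrix g g).det = (A.submatrix ((↑) : Finset.univ.image g → ι) (↑)).det := by
  let e : Fin k ≃ Finset.univ.image g :=
    (Equiv.ofInjective g hg).trans (Equiv.setCongr (by simp))
  rw [← det_submatrix_equiv_self e]
  rfl

end PrincipalMinor

section Formula

variable {ι R : Type*} [Fintype ι] [CommRing R]

theorem expectedMinor_eq_sum_antidiagonal (K : Matrix ι ι R) {w : ι → R} (hw1 : ∑ i, w i = 1)
    (x : R) (l : ℕ) {r : ℕ} (f : Fin r → ι) (z : Fin r → R) :
    expectedMinor K w x l f z = ∑ ij ∈ Finset.HasAntidiagonal.antidiagonal l,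
      l.choose ij.1 * (expectedMinor K w 0 ij.1 f z * (-x) ^ ij.2) := by
  induction l generalizing r with
  | zero => simp [expectedMinor]
  | succ l ih =>
    have hshift : expectedMinor K w x (l + 1) f z
        = (∑ i, w i * expectedMinor K w x l (Fin.cons i f : Fin (r + 1) → ι) (Fin.cons 0 z))
          + expectedMinor K w x l f z * -x := by
      have hcons i := expectedMinor_cons_add K w x l i f 0 x z
      simp only [expectedMinor, zero_add] at hcons ⊢
      simp only [hcons, mul_sub, Finset.sum_sub_distrib, ← Finset.sum_mul, hw1]
      ring
    rw [Finset.sum_antidiagonal_choose_succ_mul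
      (fun i j => expectedMinor K w 0 i f z * (-x) ^ j), hshift, ih, add_comm]
    simp only [ih, expectedMinor, Finset.mul_sum, Finset.sum_mul]
    rw [Finset.sum_comm]
    congr 1
    · refine Finset.sum_congr rfl fun ij _ => ?_
      ring
    · refine Finset.sum_congr rfl fun ij hij => Finset.sum_congr rfl fun i _ => ?_
      rw [Nat.choose_symm_of_eq_add (Finset.HasAntidiagonal.mem_antidiagonal.1 hij).symm]
      ring

theorem sum_expectedMinor_zero (K : Matrix ι ι R) (w : ι → R) {k l r : ℕ} (hk : k = l + r) :
    ∑ f : Fin r → ι, (∏ a, w (f a)) * expectedMinor K w 0 l f (fun _ => 0)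
      = ∑ g : Fin k → ι, (∏ a, w (g a)) * (K.submatrix g g).det := by
  induction l generalizing r with
  | zero =>
    obtain rfl : k = r := by lia
    simp [expectedMinor]
  | succ l ih =>
    rw [← ih (r := r + 1) (by lia), ← (Fin.consEquiv fun _ => ι).sum_comp,
      Fintype.sum_prod_type_right]
    simp only [expectedMinor, cons_const_self, Fin.consEquiv_apply, Fin.prod_univ_succ,
      Fin.cons_zero, Fin.cons_succ, Finset.mul_sum]
    exact Finset.sum_congr rfl fun f _ => Finset.sum_congr rfl fun i _ => by
      rw [← mul_assoc, mul_comm (w i)]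
      rfl

theorem expectedMinor_zero_eq_sum_det [DecidableEq ι] (K : Matrix ι ι R) (w : ι → R) (k : ℕ)
    (f : Fin 0 → ι) (z : Fin 0 → R) : expectedMinor K w 0 k f z
      = ∑ g : Fin k → ι, ((diagonal w * K).submatrix g g).det := by
  have hdet (g : Fin k → ι) : ((diagonal w * K).submatrix g g).det
      = (∏ a, w (g a)) * (K.submatrix g g).det := by
    rw [← det_mul_column]
    congr 1
    ext
    simp
  simp only [hdet, ← sum_expectedMinor_zero K w (add_zero k).symm]
  simp [Subsingleton.elim f default, Subsingleton.elim z fun _ => 0]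

variable [DecidableEq ι]

theorem card_filter_injective_image_eq {k : ℕ} {S : Finset ι} (hS : S.card = k) :
    (Finset.univ.filter fun g : Fin k → ι =>
      g.Injective ∧ Finset.univ.image g = S).card = k.factorial := by
  have hcard : Fintype.card (Fin k ≃ S) = k.factorial := by
    rw [Fintype.card_equiv (S.equivFinOfCardEq hS).symm, Fintype.card_fin]
  rw [← hcard, ← Finset.card_univ]
  symm
  refine Finset.card_bij (fun e _ a => (e a : ι)) (fun e _ => ?_) (fun e _ e' _ h => ?_)
    fun g hg => ?_
  · refine Finset.mem_filter.2 ⟨Finset.mem_univ _, Subtype.val_injective.comp e.injective, ?_⟩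
    ext i
    simpa using (e.surjective.exists (p := fun j : S => (j : ι) = i)).symm
  · exact Equiv.ext fun a => Subtype.ext (congrFun h a)
  · obtain ⟨-, hinj, rfl⟩ := Finset.mem_filter.1 hg
    exact ⟨(Equiv.ofInjective g hinj).trans (Equiv.setCongr (by simp)), Finset.mem_univ _, rfl⟩

theorem sum_det_submatrix_eq_factorial_mul (A : Matrix ι ι R) (k : ℕ) :
    ∑ g : Fin k → ι, (A.submatrix g g).det = k.factorial *
      ∑ S ∈ Finset.univ.powersetCard k, (A.submatrix (Subtype.val : S → ι) Subtype.val).det := by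
  have hsupp : ∑ g : Fin k → ι, (A.submatrix g g).det
      = ∑ g : Fin k → ι with g.Injective, (A.submatrix g g).det :=
    (Finset.sum_filter_of_ne fun g _ => injective_of_det_submatrix_ne_zero A).symm
  have hmaps (g : Fin k → ι) (hg : g ∈ Finset.univ.filter Function.Injective) :
      Finset.univ.image g ∈ Finset.univ.powersetCard k := by
    simp [Finset.mem_powersetCard, Finset.card_image_of_injective _ (Finset.mem_filter.1 hg).2]
  rw [hsupp, ← Finset.sum_fiberwise_of_maps_to hmaps, Finset.mul_sum]
  refine Finset.sum_congr rfl fun S hS => ?_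
  rw [← card_filter_injective_image_eq (Finset.mem_powersetCard.1 hS).2,
    ← nsmul_eq_mul, Finset.filter_filter]
  refine Finset.sum_eq_card_nsmul fun g hg => ?_
  obtain ⟨-, hinj, rfl⟩ := Finset.mem_filter.1 hg
  exact det_submatrix_of_injective A hinj

theorem coeff_charpolyRev_eq_sum_det (A : Matrix ι ι R) (k : ℕ) :
    A.charpolyRev.coeff k
      = (-1) ^ k *
        ∑ S ∈ Finset.univ.powersetCard k, (A.submatrix (Subtype.val : S → ι) Subtype.val).det := by
  have hneg : A.charpolyRev = det (1 + (X : R[X]) • (-A).map C) := by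
    rw [charpolyRev, Matrix.map_neg C (map_neg C), smul_neg, sub_eq_add_neg]
  rw [hneg, coeff_det_one_add_X_smul_eq_sum_minors, Finset.mul_sum]
  refine Finset.sum_congr rfl fun S hS => ?_
  refine (det_neg (A.submatrix (Subtype.val : S → ι) Subtype.val)).trans ?_
  rw [Fintype.card_coe, (Finset.mem_powersetCard.1 hS).2]

theorem aeval_derivative_X_pow (p : R[X]) (k : ℕ) :
    aeval (derivative : Module.End R R[X]) p (X ^ k)
      = ∑ j ∈ Finset.range (k + 1), (p.coeff j * k.descFactorial j) • X ^ (k - j) := by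
  induction p using Polynomial.induction_on' with
  | add p q hp hq =>
    simp only [map_add, LinearMap.add_apply, hp, hq, coeff_add, add_mul, add_smul,
      Finset.sum_add_distrib]
  | monomial j a =>
    simp only [aeval_monomial, coeff_monomial, ite_mul, zero_mul, ite_smul, zero_smul,
      Finset.sum_ite_eq, Module.algebraMap_end_eq_smul_id, smul_mul_assoc, LinearMap.smul_apply]
    rw [Module.End.mul_apply, LinearMap.id_apply, Module.End.pow_apply,
      iterate_derivative_X_pow_eq_smul]
    split_ifs with hj
    · simp [mul_smul, Nat.cast_smul_eq_nsmul]
    · rw [Nat.descFactorial_of_lt (by simpa using hj)]; simp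

theorem expectedMinorPoly_eq_aeval_derivative (K : Matrix ι ι ℝ) {w : ι → ℝ}
    (hw1 : ∑ i, w i = 1) (k : ℕ) (f : Fin 0 → ι) :
    expectedMinorPoly K w k f = (-1) ^ k *
      aeval (derivative : Module.End ℝ ℝ[X]) (charpolyRev (diagonal w * K)) (X ^ k) := by
  refine Polynomial.funext fun x => ?_
  rw [eval_expectedMinorPoly, expectedMinor_eq_sum_antidiagonal K hw1,
    Finset.Nat.sum_antidiagonal_eq_sum_range_succ_mk, aeval_derivative_X_pow, eval_mul,
    eval_finsetSum, Finset.mul_sum]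
  refine Finset.sum_congr rfl fun j hj => ?_
  have hjk : j ≤ k := Finset.mem_range_succ_iff.1 hj
  rw [expectedMinor_zero_eq_sum_det, sum_det_submatrix_eq_factorial_mul,
    coeff_charpolyRev_eq_sum_det, Nat.descFactorial_eq_factorial_mul_choose, neg_pow x]
  have hsign : (-1 : ℝ) ^ (k - j) = (-1) ^ k * (-1) ^ j := by
    obtain ⟨d, rfl⟩ := Nat.exists_eq_add_of_le hjk
    rw [Nat.add_sub_cancel_left, pow_add, mul_right_comm, ← mul_pow]
    simp
  simp [hsign]
  ring

end Formula

section ProdXSubC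

variable {κ K : Type*} [Field K]

theorem eval_prod_X_sub_C_ne_zero {s : Finset κ} {r : κ → K} {x : K} (hx : ∀ i ∈ s, r i ≠ x) :
    (∏ i ∈ s, (X - C (r i))).eval x ≠ 0 := by
  rw [eval_prod, Finset.prod_ne_zero_iff]
  exact fun i hi => by simpa [sub_eq_zero] using (hx i hi).symm

theorem eval_derivative_prod_X_sub_C {s : Finset κ} {r : κ → K} {x : K}
    (hx : ∀ i ∈ s, r i ≠ x) :
    (derivative (∏ i ∈ s, (X - C (r i)))).eval x
      = -((∏ i ∈ s, (X - C (r i))).eval x * ∑ i ∈ s, (r i - x)⁻¹) := by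
  classical
  rw [derivative_prod_finset, eval_finsetSum, Finset.mul_sum, ← Finset.sum_neg_distrib]
  refine Finset.sum_congr rfl fun i hi => ?_
  rw [← Finset.prod_erase_mul _ _ hi, ← mul_neg, ← inv_neg, neg_sub]
  have := sub_ne_zero.2 (hx i hi).symm
  simp [this]

theorem eval_derivative_derivative_prod_X_sub_C {s : Finset κ} {r : κ → K} {x : K}
    (hx : ∀ i ∈ s, r i ≠ x) :
    (derivative (derivative (∏ i ∈ s, (X - C (r i))))).eval x
      = (∏ i ∈ s, (X - C (r i))).eval x
        * ((∑ i ∈ s, (r i - x)⁻¹) ^ 2 - ∑ i ∈ s, (r i - x)⁻¹ ^ 2) := by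
  induction s using Finset.cons_induction with
  | empty => simp
  | cons a s ha ih =>
    rw [Finset.forall_mem_cons] at hx
    have := sub_ne_zero.2 hx.1
    simp only [Finset.prod_cons, Finset.sum_cons, derivative_mul, derivative_add, derivative_sub,
      derivative_X, derivative_C, sub_zero, one_mul, eval_add, eval_mul, eval_sub, eval_X, eval_C,
      ih hx.2, eval_derivative_prod_X_sub_C hx.2]
    field_simp
    ring

theorem eval_sub_derivative_prod_X_sub_C {s : Finset κ} {r : κ → K} (μ : K) {x : K}
    (hx : ∀ i ∈ s, r i ≠ x) :
    (∏ i ∈ s, (X - C (r i)) - C μ * derivative (∏ i ∈ s, (X - C (r i)))).eval x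
      = (∏ i ∈ s, (X - C (r i))).eval x * (1 + μ * ∑ i ∈ s, (r i - x)⁻¹) := by
  rw [eval_sub, eval_mul, eval_C, eval_derivative_prod_X_sub_C hx]
  ring

theorem exists_eq_prod_X_sub_C [Fintype κ] {q : K[X]} (hs : q.Splits) (hm : q.Monic)
    (hd : q.natDegree = Fintype.card κ) : ∃ r : κ → K, q = ∏ i, (X - C (r i)) := by
  classical
  let e : κ ≃ q.roots :=
    Fintype.equivOfCardEq (by rw [Multiset.card_coe, ← hd, hs.natDegree_eq_card_roots])
  refine ⟨fun i => (e i).1, ?_⟩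
  conv_lhs => rw [hs.eq_prod_roots_of_monic hm, ← Multiset.map_univ]
  exact (e.prod_comp fun i : q.roots => X - C i.1).symm

end ProdXSubC

section SubDerivative

theorem splits_of_aeval_ne_zero {q : ℝ[X]} (h : ∀ z : ℂ, z.im ≠ 0 → aeval z q ≠ 0) :
    q.Splits := by
  refine (IsAlgClosed.splits (q.map (algebraMap ℝ ℂ))).of_splits_map _ fun z hz => ?_
  have hz0 : aeval z q = 0 := by
    rw [← eval_map_algebraMap]
    exact isRoot_of_mem_roots hz
  have him : z.im = 0 := by
    by_contra hc
    exact h z hc hz0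
  exact ⟨z.re, Complex.ext (by simp) (by simp [him])⟩

theorem degree_C_mul_derivative_lt {R : Type*} [Semiring R] {p : R[X]} (hp : p ≠ 0) (μ : R) :
    (C μ * derivative p).degree < p.degree := by
  rw [← smul_eq_C_mul]
  exact (degree_smul_le _ _).trans_lt (degree_derivative_lt hp)

theorem natDegree_sub_derivative {R : Type*} [Ring R] (p : R[X]) (μ : R) :
    (p - C μ * derivative p).natDegree = p.natDegree := by
  rcases eq_or_ne p 0 with rfl | hp
  · simp
  · exact natDegree_eq_of_degree_eq
      (degree_sub_eq_left_of_degree_lt (degree_C_mul_derivative_lt hp μ))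

variable {κ : Type*} [Fintype κ]

theorem im_sum_inv_ofReal_sub_ne_zero [Nonempty κ] (r : κ → ℝ) {z : ℂ} (hz : z.im ≠ 0) :
    (∑ i, ((r i : ℂ) - z)⁻¹).im ≠ 0 := by
  have him (i : κ) : ((r i : ℂ) - z)⁻¹.im = z.im * (Complex.normSq (r i - z))⁻¹ := by
    simp [Complex.inv_im, div_eq_mul_inv]
  simp only [Complex.im_sum, him, ← Finset.mul_sum]
  refine mul_ne_zero hz (Finset.sum_pos (fun i _ => ?_) Finset.univ_nonempty).ne'
  refine inv_pos.2 (Complex.normSq_pos.2 fun h => hz ?_)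
  rw [← sub_eq_zero.1 h, Complex.ofReal_im]

theorem splits_sub_derivative (r : κ → ℝ) (μ : ℝ) :
    (∏ i, (X - C (r i)) - C μ * derivative (∏ i, (X - C (r i)))).Splits := by
  refine splits_of_aeval_ne_zero fun z hz => ?_
  have hzr : ∀ i ∈ Finset.univ, (r i : ℂ) ≠ z := fun i _ h => hz (by rw [← h, Complex.ofReal_im])
  have hmap : (∏ i, (X - C (r i))).map (algebraMap ℝ ℂ) = ∏ i, (X - C (r i : ℂ)) := by
    simp [Polynomial.map_prod]
  rw [← eval_map_algebraMap, Polynomial.map_sub, Polynomial.map_mul, ← derivative_map, hmap, map_C,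
    eval_sub_derivative_prod_X_sub_C _ hzr]
  refine mul_ne_zero (eval_prod_X_sub_C_ne_zero hzr) fun h => ?_
  rcases isEmpty_or_nonempty κ with hκ | hκ
  · simp at h
  have him := congrArg Complex.im h
  rw [Complex.coe_algebraMap, Complex.add_im, Complex.im_ofReal_mul, Complex.one_im, zero_add,
    Complex.zero_im, mul_eq_zero, or_iff_left (im_sum_inv_ofReal_sub_ne_zero r hz)] at him
  simp [him] at h

theorem exists_sub_derivative_eq_prod_X_sub_C (r : κ → ℝ) (μ : ℝ) :
    ∃ r' : κ → ℝ, ∏ i, (X - C (r i)) - C μ * derivative (∏ i, (X - C (r i)))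
      = ∏ i, (X - C (r' i)) := by
  have hmonic : (∏ i, (X - C (r i))).Monic := monic_prod_X_sub_C r Finset.univ
  refine exists_eq_prod_X_sub_C (splits_sub_derivative r μ)
    (hmonic.sub_of_left (degree_C_mul_derivative_lt hmonic.ne_zero μ)) ?_
  rw [natDegree_sub_derivative, natDegree_finsetProd_X_sub_C_eq_card, Finset.card_univ]

theorem lt_roots_sub_derivative {r r' : κ → ℝ} {μ y : ℝ} (hμ : 0 ≤ μ)
    (hr' : ∏ i, (X - C (r i)) - C μ * derivative (∏ i, (X - C (r i))) = ∏ i, (X - C (r' i)))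
    (hy : ∀ i, y < r i) (j : κ) : y < r' j := by
  by_contra! hj
  have hlt i : r' j < r i := hj.trans_lt (hy i)
  have hzero : (∏ i, (X - C (r' i))).eval (r' j) = 0 := by
    rw [eval_prod]
    exact Finset.prod_eq_zero (Finset.mem_univ j) (by simp)
  rw [← hr', eval_sub_derivative_prod_X_sub_C _ fun i _ => (hlt i).ne'] at hzero
  have hsum : 0 ≤ ∑ i, (r i - r' j)⁻¹ :=
    Finset.sum_nonneg fun i _ => inv_nonneg.2 (sub_pos.2 (hlt i)).le
  exact mul_ne_zero (eval_prod_X_sub_C_ne_zero fun i _ => (hlt i).ne') (by positivity) hzero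

theorem sum_inv_roots_sub_derivative_mul {K : Type*} [Field K] {r r' : κ → K} {μ y : K}
    (hr' : ∏ i, (X - C (r i)) - C μ * derivative (∏ i, (X - C (r i))) = ∏ i, (X - C (r' i)))
    (hy : ∀ i, r i ≠ y) (hy' : ∀ i, r' i ≠ y) :
    (∑ i, (r' i - y)⁻¹) * (1 + μ * ∑ i, (r i - y)⁻¹)
      = (∑ i, (r i - y)⁻¹) * (1 + μ * ∑ i, (r i - y)⁻¹) - μ * ∑ i, (r i - y)⁻¹ ^ 2 := by
  have hderiv := eval_derivative_prod_X_sub_C (s := Finset.univ) fun i _ => hy' i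
  rw [← hr', eval_sub_derivative_prod_X_sub_C μ fun i _ => hy i, derivative_sub, derivative_C_mul,
    eval_sub, eval_mul, eval_C, eval_derivative_prod_X_sub_C fun i _ => hy i,
    eval_derivative_derivative_prod_X_sub_C fun i _ => hy i] at hderiv
  refine mul_left_cancel₀ (eval_prod_X_sub_C_ne_zero (s := Finset.univ) fun i _ => hy i) ?_
  linear_combination hderiv

end SubDerivative

section Barrier

variable {κ : Type*} [Fintype κ]

theorem sum_inv_sub_eq {K : Type*} [Field K] {s : κ → K} {δ : K} (hs0 : ∀ i, s i ≠ 0)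
    (hs : ∀ i, s i ≠ δ) :
    ∑ i, (s i - δ)⁻¹ = ∑ i, (s i)⁻¹ + δ * ∑ i, (s i * (s i - δ))⁻¹ := by
  rw [Finset.mul_sum, ← Finset.sum_add_distrib]
  refine Finset.sum_congr rfl fun i _ => ?_
  have := hs0 i
  have := sub_ne_zero.2 (hs i)
  field_simp
  ring

theorem sum_inv_sub_sq_eq {K : Type*} [Field K] {s : κ → K} {δ : K} (hs0 : ∀ i, s i ≠ 0)
    (hs : ∀ i, s i ≠ δ) :
    ∑ i, (s i - δ)⁻¹ ^ 2 = ∑ i, (s i * (s i - δ))⁻¹ + δ * ∑ i, (s i * (s i - δ) ^ 2)⁻¹ := by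
  rw [Finset.mul_sum, ← Finset.sum_add_distrib]
  refine Finset.sum_congr rfl fun i _ => ?_
  have := hs0 i
  have := sub_ne_zero.2 (hs i)
  field_simp
  ring

theorem mul_sum_inv_mul_sq_le {s : κ → ℝ} {δ : ℝ} (hδ : 0 ≤ δ) (hs : ∀ i, δ < s i)
    (h : δ * ∑ i, (s i)⁻¹ ≤ 1) :
    δ * (∑ i, (s i * (s i - δ))⁻¹) ^ 2 ≤ ∑ i, (s i * (s i - δ) ^ 2)⁻¹ := by
  have hs0 i : 0 < s i := hδ.trans_lt (hs i)
  have hsδ i : 0 < s i - δ := sub_pos.2 (hs i)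
  have hW0 i : 0 ≤ (s i * (s i - δ) ^ 2)⁻¹ := inv_nonneg.2 (mul_pos (hs0 i) (pow_pos (hsδ i) 2)).le
  have hcs : (∑ i, (s i * (s i - δ))⁻¹) ^ 2
      ≤ (∑ i, (s i)⁻¹) * ∑ i, (s i * (s i - δ) ^ 2)⁻¹ :=
    Finset.sum_sq_le_sum_mul_sum_of_sq_le_mul _ (fun i _ => inv_nonneg.2 (hs0 i).le)
      (fun i _ => hW0 i) fun i _ => le_of_eq (by
        have := (hs0 i).ne'
        have := (hsδ i).ne'
        field_simp)
  calc δ * (∑ i, (s i * (s i - δ))⁻¹) ^ 2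
      ≤ δ * ((∑ i, (s i)⁻¹) * ∑ i, (s i * (s i - δ) ^ 2)⁻¹) := by gcongr
    _ = (δ * ∑ i, (s i)⁻¹) * ∑ i, (s i * (s i - δ) ^ 2)⁻¹ := by ring
    _ ≤ ∑ i, (s i * (s i - δ) ^ 2)⁻¹ :=
      mul_le_of_le_one_left (Finset.sum_nonneg fun i _ => hW0 i) h

theorem barrier_inequality {s : κ → ℝ} {φ μ δ : ℝ} (hμ : 0 ≤ μ) (hφ : 0 ≤ φ)
    (hδ : δ = μ / (1 + μ * φ)) (hs : ∀ i, δ < s i) (h : ∑ i, (s i)⁻¹ ≤ φ) :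
    (∑ i, (s i - δ)⁻¹ - φ) * (1 + μ * ∑ i, (s i - δ)⁻¹) ≤ μ * ∑ i, (s i - δ)⁻¹ ^ 2 := by
  have hden : 0 < 1 + μ * φ := by positivity
  have hδ0 : 0 ≤ δ := hδ ▸ div_nonneg hμ hden.le
  have hδμ : δ * (1 + μ * φ) = μ := hδ ▸ div_mul_cancel₀ _ hden.ne'
  have hs0 i : 0 < s i := hδ0.trans_lt (hs i)
  have hsδ i : 0 < s i - δ := sub_pos.2 (hs i)
  have hΦ := sum_inv_sub_eq (fun i => (hs0 i).ne') fun i => (hs i).ne'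
  have hΨ := sum_inv_sub_sq_eq (fun i => (hs0 i).ne') fun i => (hs i).ne'
  have hΦ0 : 0 ≤ ∑ i, (s i - δ)⁻¹ := Finset.sum_nonneg fun i _ => (inv_pos.2 (hsδ i)).le
  have : 0 ≤ ∑ i, (s i - δ)⁻¹ ^ 2 := Finset.sum_nonneg fun i _ => sq_nonneg _
  have hδφ : δ * φ ≤ 1 := by
    refine le_of_mul_le_mul_right ?_ hden
    linear_combination φ * hδμ + zero_le_one' ℝ
  have hU := mul_sum_inv_mul_sq_le hδ0 hs ((mul_le_mul_of_nonneg_left h hδ0).trans hδφ)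
  have hU0 : 0 ≤ ∑ i, (s i * (s i - δ))⁻¹ :=
    Finset.sum_nonneg fun i _ => (inv_pos.2 (mul_pos (hs0 i) (hsδ i))).le
  set Φ := ∑ i, (s i - δ)⁻¹
  set U := ∑ i, (s i * (s i - δ))⁻¹
  rcases le_total (Φ - φ) 0 with hneg | hpos
  · exact (mul_nonpos_of_nonpos_of_nonneg hneg (by positivity)).trans (by positivity)
  · have hΦU : Φ - φ ≤ δ * U := by linarith
    calc (Φ - φ) * (1 + μ * Φ) = (Φ - φ) * (1 + μ * φ + μ * (Φ - φ)) := by ring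
      _ ≤ (δ * U) * (1 + μ * φ + μ * (δ * U)) := by gcongr
      _ = (δ * (1 + μ * φ)) * U + μ * (δ * (δ * U ^ 2)) := by ring
      _ ≤ (δ * (1 + μ * φ)) * U + μ * (δ * ∑ i, (s i * (s i - δ) ^ 2)⁻¹) := by gcongr
      _ = μ * ∑ i, (s i - δ)⁻¹ ^ 2 := by rw [hδμ, hΨ]; ring

theorem inv_le_of_sum_inv_le {t : κ → ℝ} {φ : ℝ} (ht : ∀ i, 0 < t i)
    (h : ∑ i, (t i)⁻¹ ≤ φ) (i : κ) : φ⁻¹ ≤ t i :=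
  inv_le_of_inv_le₀ (ht i) <| h.trans' <|
    Finset.single_le_sum (fun j _ => (inv_pos.2 (ht j)).le) (Finset.mem_univ i)

theorem inv_lt_of_sum_inv_le [Nontrivial κ] {t : κ → ℝ} {φ : ℝ} (ht : ∀ i, 0 < t i)
    (h : ∑ i, (t i)⁻¹ ≤ φ) (i : κ) : φ⁻¹ < t i := by
  obtain ⟨j, hj⟩ := exists_ne i
  exact inv_lt_of_inv_lt₀ (ht i) <| h.trans_lt' <| Finset.single_lt_sum hj (Finset.mem_univ i)
    (Finset.mem_univ j) (inv_pos.2 (ht j)) fun m _ _ => (inv_pos.2 (ht m)).le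

theorem exists_roots_sub_derivative {r : κ → ℝ} {b φ μ : ℝ} (hμ : 0 ≤ μ)
    (hφ : 0 < φ) (hb : ∀ i, b < r i) (h : ∑ i, (r i - b)⁻¹ ≤ φ) :
    ∃ r' : κ → ℝ,
      ∏ i, (X - C (r i)) - C μ * derivative (∏ i, (X - C (r i))) = ∏ i, (X - C (r' i)) ∧
      (∀ i, b + μ / (1 + μ * φ) < r' i) ∧ ∑ i, (r' i - (b + μ / (1 + μ * φ)))⁻¹ ≤ φ := by
  have hden : 0 < 1 + μ * φ := by positivity
  set δ := μ / (1 + μ * φ) with hδ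
  have hδφ : δ < φ⁻¹ := by
    rw [hδ, div_lt_iff₀ hden, mul_add, mul_one, mul_comm μ, inv_mul_cancel_left₀ hφ.ne']
    exact lt_add_of_pos_left μ (inv_pos.2 hφ)
  have hs i : δ < r i - b :=
    hδφ.trans_le (inv_le_of_sum_inv_le (fun i => sub_pos.2 (hb i)) h i)
  have hy i : b + δ < r i := lt_sub_iff_add_lt'.1 (hs i)
  obtain ⟨r', hr'⟩ := exists_sub_derivative_eq_prod_X_sub_C r μ
  have hy' := lt_roots_sub_derivative hμ hr' hy
  refine ⟨r', hr', hy', ?_⟩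
  have hΦ' := sum_inv_roots_sub_derivative_mul hr' (fun i => (hy i).ne') fun i => (hy' i).ne'
  have hbarrier := barrier_inequality hμ hφ.le hδ hs h
  simp only [sub_sub] at hbarrier
  have hΦ0 : 0 ≤ ∑ i, (r i - (b + δ))⁻¹ :=
    Finset.sum_nonneg fun i _ => (inv_pos.2 (sub_pos.2 (hy i))).le
  refine le_of_mul_le_mul_right ?_ (by positivity : 0 < 1 + μ * ∑ i, (r i - (b + δ))⁻¹)
  linarith

theorem exists_roots_aeval_derivative {ι : Type*} (s : Finset ι) {μ : ι → ℝ} (hμ : ∀ i, 0 ≤ μ i)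
    [Nonempty κ] {φ : ℝ} (hφ : 0 < φ) :
    ∃ r : κ → ℝ,
      aeval (derivative : Module.End ℝ ℝ[X]) (∏ i ∈ s, (1 - C (μ i) * X)) (X ^ Fintype.card κ)
        = ∏ i, (X - C (r i)) ∧
      (∀ i, -(Fintype.card κ / φ) + ∑ i ∈ s, μ i / (1 + μ i * φ) < r i) ∧
      ∑ i, (r i - (-(Fintype.card κ / φ) + ∑ i ∈ s, μ i / (1 + μ i * φ)))⁻¹ ≤ φ := by
  have hcard : (0 : ℝ) < Fintype.card κ := Nat.cast_pos.2 Fintype.card_pos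
  induction s using Finset.cons_induction with
  | empty =>
    refine ⟨0, by simp, fun i => ?_, ?_⟩
    · simpa using div_pos hcard hφ
    · simp [mul_div_cancel₀ _ hcard.ne']
  | cons a s ha ih =>
    obtain ⟨r, hr, hlt, hle⟩ := ih
    obtain ⟨r', hr', hlt', hle'⟩ := exists_roots_sub_derivative (hμ a) hφ hlt hle
    rw [Finset.sum_cons, add_comm (μ a / _), ← add_assoc]
    refine ⟨r', ?_, hlt', hle'⟩
    rw [← hr', ← hr, Finset.prod_cons, map_mul, Module.End.mul_apply]
    simp [Algebra.algebraMap_eq_smul_one, smul_eq_C_mul]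

theorem one_div_one_add_le_sum {μ : κ → ℝ} (hμ : ∀ i, 0 ≤ μ i) (h1 : ∑ i, μ i = 1) {φ : ℝ}
    (hφ : 0 ≤ φ) : 1 / (1 + (∑ i, μ i ^ 2) * φ) ≤ ∑ i, μ i / (1 + μ i * φ) := by
  have hden i : 0 < 1 + μ i * φ := by have := hμ i; positivity
  have hsum : ∑ i, μ i * (1 + μ i * φ) = 1 + (∑ i, μ i ^ 2) * φ := by
    simp only [mul_add, mul_one, Finset.sum_add_distrib, h1, Finset.sum_mul, sq, mul_assoc]
  have hcs : (∑ i, μ i) ^ 2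
      ≤ (∑ i, μ i / (1 + μ i * φ)) * ∑ i, μ i * (1 + μ i * φ) :=
    Finset.sum_sq_le_sum_mul_sum_of_sq_le_mul _ (fun i _ => div_nonneg (hμ i) (hden i).le)
      (fun i _ => mul_nonneg (hμ i) (hden i).le) fun i _ => le_of_eq (by
        have := (hden i).ne'
        field_simp)
  have hpos : 0 < 1 + (∑ i, μ i ^ 2) * φ := by positivity
  rwa [h1, one_pow, hsum, ← div_le_iff₀ hpos] at hcs

theorem exists_roots_aeval_derivative_gt_sq {μ : κ → ℝ} (hμ : ∀ i, 0 ≤ μ i)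
    (h1 : ∑ i, μ i = 1) {k : ℕ} {ε : ℝ} (hε₀ : 0 < ε) (hε₁ : ε < 1)
    (hk : k * ∑ i, μ i ^ 2 ≤ (1 - ε) ^ 2) :
    ∃ r : Fin (k + 1) → ℝ,
      aeval (derivative : Module.End ℝ ℝ[X]) (∏ i, (1 - C (μ i) * X)) (X ^ (k + 1))
        = ∏ i, (X - C (r i)) ∧ ∀ i, ε ^ 2 < r i := by
  have hτ : 0 < ∑ i, μ i ^ 2 := by
    obtain ⟨i, -, hi⟩ := Finset.exists_ne_zero_of_sum_ne_zero (h1.trans_ne one_ne_zero)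
    exact Finset.sum_pos' (fun i _ => sq_nonneg _) ⟨i, Finset.mem_univ i, by positivity⟩
  have hε : 0 < 1 - ε := sub_pos.2 hε₁
  set φ := (1 - ε) / ((∑ i, μ i ^ 2) * ε) with hφ
  have hφ0 : 0 < φ := by positivity
  have hshift : ε ≤ ∑ i, μ i / (1 + μ i * φ) := by
    refine (one_div_one_add_le_sum hμ h1 hφ0.le).trans_eq' ?_
    rw [hφ, mul_div_assoc', mul_div_mul_left _ _ hτ.ne']
    field_simp
    ring
  have hkφ : k / φ ≤ ε * (1 - ε) := by
    rw [div_le_iff₀ hφ0, hφ, mul_div_assoc', le_div_iff₀ (by positivity)]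
    linear_combination ε * hk
  obtain ⟨r, hr, hlt, hle⟩ :=
    exists_roots_aeval_derivative (κ := Fin (k + 1)) Finset.univ hμ hφ0
  rw [Fintype.card_fin] at hr hlt hle
  set y := -((k + 1 : ℕ) / φ) + ∑ i, μ i / (1 + μ i * φ) with hy
  have hy' : ε - k / φ ≤ y + φ⁻¹ := by
    rw [hy, Nat.cast_add_one, add_div, one_div]
    linarith
  have hpos i : 0 < r i - y := sub_pos.2 (hlt i)
  refine ⟨r, hr, fun i => ?_⟩
  rcases k.eq_zero_or_pos with rfl | hk0
  · have := inv_le_of_sum_inv_le hpos hle i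
    rw [Nat.cast_zero, zero_div] at hy'
    nlinarith
  · have : Nontrivial (Fin (k + 1)) := Fin.nontrivial_iff_two_le.2 (by lia)
    have := inv_lt_of_sum_inv_le hpos hle i
    nlinarith

end Barrier

section CharpolyRev

variable {κ R : Type*} [Fintype κ] [DecidableEq κ] [CommRing R]

theorem charpolyRev_mul_comm (M N : Matrix κ κ R) :
    (M * N).charpolyRev = (N * M).charpolyRev := by
  rw [← reverse_charpoly, charpoly_mul_comm, reverse_charpoly]

theorem charpolyRev_smul (c : R) (M : Matrix κ κ R) :
    (c • M).charpolyRev = M.charpolyRev.comp (C c * X) := by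
  rw [← coe_compRingHom_apply, charpolyRev, charpolyRev, RingHom.map_det]
  congr 1
  refine Matrix.ext fun i j => ?_
  by_cases hij : i = j <;> simp [hij] <;> ring

theorem charpolyRev_eq_prod_of_charpoly_eq_prod {M : Matrix κ κ R} {μ : κ → R}
    (h : M.charpoly = ∏ i, (X - C (μ i))) : M.charpolyRev = ∏ i, (1 - C (μ i) * X) := by
  rw [← reverse_charpoly, h, ← charpoly_diagonal, reverse_charpoly, charpolyRev, diagonal_map
    (map_zero C), ← diagonal_one, ← diagonal_smul, diagonal_sub, det_diagonal]
  exact Finset.prod_congr rfl fun i _ => by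
    rw [Pi.smul_apply, smul_eq_mul, mul_comm]

theorem charpolyRev_smul_eq_prod {M : Matrix κ κ R} {μ : κ → R}
    (h : M.charpoly = ∏ i, (X - C (μ i))) (c : R) :
    (c • M).charpolyRev = ∏ i, (1 - C (c * μ i) * X) := by
  rw [charpolyRev_smul, charpolyRev_eq_prod_of_charpoly_eq_prod h, prod_comp]
  refine Finset.prod_congr rfl fun i _ => ?_
  rw [sub_comp, one_comp, mul_comp, C_comp, X_comp, ← mul_assoc, ← C_mul, mul_comm c]

end CharpolyRev

theorem eval_expectedMinorPoly_pos_of_charpolyRev {ι κ : Type*} [Fintype ι] [DecidableEq ι]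
    [Fintype κ] {K : Matrix ι ι ℝ} {w : ι → ℝ} (hw1 : ∑ i, w i = 1) {μ : κ → ℝ}
    (hchar : (diagonal w * K).charpolyRev = ∏ i, (1 - C (μ i) * X))
    (hμ : ∀ i, 0 ≤ μ i) (hμ1 : ∑ i, μ i = 1) {k : ℕ} {ε : ℝ} (hε₀ : 0 < ε) (hε₁ : ε < 1)
    (hk : k * ∑ i, μ i ^ 2 ≤ (1 - ε) ^ 2) (f : Fin 0 → ι) {x : ℝ} (hx : x ≤ ε ^ 2) :
    0 < (expectedMinorPoly K w (k + 1) f).eval x := by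
  obtain ⟨r, hr, hlt⟩ := exists_roots_aeval_derivative_gt_sq hμ hμ1 hε₀ hε₁ hk
  have hprod : (expectedMinorPoly K w (k + 1) f).eval x = ∏ i, (r i - x) := by
    have hsign : (-1) ^ (k + 1) * ∏ i, (x - r i) = ∏ i, (r i - x) := by
      simp_rw [← neg_sub x, Finset.prod_neg, Finset.card_univ, Fintype.card_fin]
    rw [expectedMinorPoly_eq_aeval_derivative K hw1, hchar, hr, ← hsign]
    simp [eval_prod]
  rw [hprod]
  exact Finset.prod_pos fun i _ => sub_pos.2 (hx.trans_lt (hlt i))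

section LeastSingularValue

variable {κ : Type*} [Fintype κ] [DecidableEq κ]

theorem posSemidef_sub_diagonal_of_det_ne_zero {G : Matrix κ κ ℝ} (hG : G.IsHermitian) {b : ℝ}
    (h : ∀ x ≤ b, (G - diagonal fun _ => x).det ≠ 0) :
    (G - diagonal fun _ => b).PosSemidef := by
  have hH : (G - diagonal fun _ => b).IsHermitian := hG.sub (isHermitian_diagonal _)
  rw [hH.posSemidef_iff_eigenvalues_nonneg]
  intro i
  by_contra! hneg
  have hroot : (G - diagonal fun _ => b).charpoly.eval (hH.eigenvalues i) = 0 := by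
    rw [hH.charpoly_eq, eval_prod]
    exact Finset.prod_eq_zero (Finset.mem_univ i) (by simp)
  rw [eval_charpoly, ← neg_sub, det_neg, scalar_apply, sub_sub, diagonal_add] at hroot
  exact mul_ne_zero (by simp) (h (b + hH.eigenvalues i) (by simpa using hneg.le)) hroot

theorem mul_norm_sq_le_of_posSemidef {ι : Type*} [Fintype ι] {N : Matrix ι κ ℝ} {b : ℝ}
    (h : (Nᵀ * N - diagonal fun _ => b).PosSemidef) (y : EuclideanSpace ℝ κ) :
    b * ‖y‖ ^ 2 ≤ ‖N.toEuclideanLin y‖ ^ 2 := by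
  have hgram : y.ofLp ⬝ᵥ (Nᵀ * N) *ᵥ y.ofLp = ‖N.toEuclideanLin y‖ ^ 2 := by
    rw [← mulVec_mulVec, dotProduct_mulVec, vecMul_transpose, EuclideanSpace.real_norm_sq_eq,
      ofLp_toLpLin, toLin'_apply]
    simp only [dotProduct, sq]
  have hscalar : y.ofLp ⬝ᵥ (diagonal fun _ => b) *ᵥ y.ofLp = b * ‖y‖ ^ 2 := by
    rw [EuclideanSpace.real_norm_sq_eq, Finset.mul_sum]
    simp only [dotProduct, mulVec_diagonal, sq, mul_left_comm]
  have hquad := h.dotProduct_mulVec_nonneg y.ofLp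
  rwa [star_trivial, sub_mulVec, dotProduct_sub, hgram, hscalar, sub_nonneg] at hquad

theorem le_sigmaMin_of_det_ne_zero [Nonempty κ] {n : ℕ} {N : Matrix (Fin n) κ ℝ} {ε : ℝ}
    (h : ∀ x ≤ ε ^ 2, (Nᵀ * N - diagonal fun _ => x).det ≠ 0) : ε ≤ sigmaMin N := by
  have hsphere : Nonempty (Metric.sphere (0 : EuclideanSpace ℝ κ) 1) :=
    (NormedSpace.sphere_nonempty.2 zero_le_one).to_subtype
  have hG : (Nᵀ * N).IsHermitian := by simpa using isHermitian_conjTranspose_mul_self N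
  refine le_ciInf fun y => le_of_sq_le_sq ?_ (norm_nonneg _)
  simpa using mul_norm_sq_le_of_posSemidef (posSemidef_sub_diagonal_of_det_ne_zero hG h) y.1

end LeastSingularValue

section ColumnSelection

variable {n m : ℕ}

theorem submatrix_sub_diagonal_const {ι κ R : Type*} [DecidableEq ι] [DecidableEq κ] [Ring R]
    (A : Matrix ι ι R) {g : κ → ι} (hg : g.Injective) (x : R) :
    (A - diagonal fun _ => x).submatrix g g = A.submatrix g g - diagonal fun _ => x := by
  rw [submatrix_sub, Pi.sub_apply, Pi.sub_apply, submatrix_diagonal _ _ hg, Function.comp_def]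

theorem exists_card_eq_le_sigmaMin_colsSubmatrix (M : Matrix (Fin n) (Fin m) ℝ) {k : ℕ} {ε : ℝ}
    {g : Fin (k + 1) → Fin m}
    (hg : ∀ x ≤ ε ^ 2, 0 < ((Mᵀ * M).submatrix g g - diagonal fun _ => x).det) :
    ∃ S : Finset (Fin m), S.card = k + 1 ∧ ε ≤ sigmaMin (colsSubmatrix M S) := by
  have hinj : g.Injective := by
    refine injective_of_det_submatrix_ne_zero (Mᵀ * M) ?_
    simpa using (hg 0 (sq_nonneg ε)).ne'
  have hcard : (Finset.univ.image g).card = k + 1 := by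
    rw [Finset.card_image_of_injective _ hinj, Finset.card_univ, Fintype.card_fin]
  have hne : Nonempty (Finset.univ.image g) := (Finset.univ_nonempty.image g).to_subtype
  refine ⟨Finset.univ.image g, hcard, le_sigmaMin_of_det_ne_zero fun x hx => ?_⟩
  have hgram (S : Finset (Fin m)) : (colsSubmatrix M S)ᵀ * colsSubmatrix M S
      = (Mᵀ * M).submatrix Subtype.val Subtype.val := rfl
  rw [hgram, ← submatrix_sub_diagonal_const _ Subtype.val_injective,
    ← det_submatrix_of_injective _ hinj, submatrix_sub_diagonal_const _ hinj]
  exact (hg x hx).ne'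

end ColumnSelection

section SingularValues

variable {n m : ℕ}

theorem charpoly_transpose_mul_self (A : Matrix (Fin n) (Fin m) ℝ) :
    (Aᵀ * A).charpoly = ∏ i : Fin m, (X - C (A.toEuclideanLin.singularValues i ^ 2)) := by
  have hcomp : A.toEuclideanLin.adjoint ∘ₗ A.toEuclideanLin = (Aᵀ * A).toEuclideanLin := by
    rw [← toEuclideanLin_conjTranspose_eq_adjoint, conjTranspose_eq_transpose_of_trivial]
    ext
    simp
  have hm : Module.finrank ℝ (EuclideanSpace ℝ (Fin m)) = m := finrank_euclideanSpace_fin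
  have hcharpoly : (Aᵀ * A).toEuclideanLin.charpoly = (Aᵀ * A).charpoly := by
    rw [toEuclideanLin, toLpLin_eq_toLin]
    exact charpoly_toLin _ _
  rw [← hcharpoly, ← hcomp, A.toEuclideanLin.isSymmetric_adjoint_comp_self.charpoly_eq hm]
  refine Finset.prod_congr rfl fun i _ => ?_
  rw [A.toEuclideanLin.sq_singularValues_fin hm]
  rfl

theorem trace_eq_sum_of_charpoly_eq_prod {κ R : Type*} [Fintype κ] [DecidableEq κ] [CommRing R]
    {M : Matrix κ κ R} {μ : κ → R} (h : M.charpoly = ∏ i, (X - C (μ i))) :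
    M.trace = ∑ i, μ i := by
  rw [← trace_diagonal]
  rw [← charpoly_diagonal] at h
  rw [trace_eq_neg_charpoly_nextCoeff, h, ← trace_eq_neg_charpoly_nextCoeff]

theorem norm_toLp_col_sq {ι κ : Type*} [Fintype ι] (A : Matrix ι κ ℝ) (j : κ) :
    ‖WithLp.toLp 2 (A.col j)‖ ^ 2 = (Aᵀ * A) j j := by
  rw [EuclideanSpace.real_norm_sq_eq, mul_apply]
  simp only [col_apply, transpose_apply, sq]

theorem sum_sq_singularValues_eq_sum_sq_norm_col (A : Matrix (Fin n) (Fin m) ℝ) :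
    ∑ i : Fin m, A.toEuclideanLin.singularValues i ^ 2 = ∑ j, ‖WithLp.toLp 2 (A.col j)‖ ^ 2 := by
  rw [← trace_eq_sum_of_charpoly_eq_prod (charpoly_transpose_mul_self A), trace]
  simp only [norm_toLp_col_sq, diag_apply]

end SingularValues

section Weights

variable {n m : ℕ} (A : Matrix (Fin n) (Fin m) ℝ)

/-- The probabilities `‖aⱼ‖² / ‖A‖²` (Frobenius norm), with which the columns of `A` are drawn. -/
noncomputable def columnWeight (j : Fin m) : ℝ :=
  ‖WithLp.toLp 2 (A.col j)‖ ^ 2 / ∑ l, ‖WithLp.toLp 2 (A.col l)‖ ^ 2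

/-- The squared singular values of `A`, normalized to sum to one. -/
noncomputable def spectralWeight (i : Fin m) : ℝ :=
  A.toEuclideanLin.singularValues i ^ 2 / ∑ l : Fin m, A.toEuclideanLin.singularValues l ^ 2

theorem columnWeight_nonneg (j : Fin m) : 0 ≤ columnWeight A j := by
  unfold columnWeight
  positivity

theorem spectralWeight_nonneg (i : Fin m) : 0 ≤ spectralWeight A i := by
  unfold spectralWeight
  positivity

theorem normalizeCols_mul_diagonal :
    normalizeCols A * diagonal (fun j => ‖WithLp.toLp 2 (A.col j)‖) = A := by
  ext i j
  rw [mul_diagonal, normalizeCols, of_apply]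
  refine div_mul_cancel_of_imp fun h => ?_
  rw [norm_eq_zero, WithLp.toLp_eq_zero] at h
  exact congrFun h i

theorem charpolyRev_columnWeight_mul_gram :
    (diagonal (columnWeight A) * ((normalizeCols A)ᵀ * normalizeCols A)).charpolyRev
      = ∏ i, (1 - C (spectralWeight A i) * X) := by
  set s := ∑ j, ‖WithLp.toLp 2 (A.col j)‖ ^ 2 with hs
  set D : Matrix (Fin m) (Fin m) ℝ := diagonal fun j => ‖WithLp.toLp 2 (A.col j)‖ with hD
  set N := normalizeCols A
  have hND : N * D = A := normalizeCols_mul_diagonal A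
  have hw : diagonal (columnWeight A) = s⁻¹ • (D * D) := by
    rw [hD, diagonal_mul_diagonal, ← diagonal_smul]
    congr 1 with j
    rw [Pi.smul_apply, smul_eq_mul, columnWeight, ← hs, div_eq_inv_mul, sq]
  calc (diagonal (columnWeight A) * (Nᵀ * N)).charpolyRev
      = (D * (s⁻¹ • (D * (Nᵀ * N)))).charpolyRev := by
        rw [hw, Matrix.smul_mul, Matrix.mul_smul, Matrix.mul_assoc]
    _ = (s⁻¹ • (Aᵀ * A)).charpolyRev := by
        rw [charpolyRev_mul_comm, Matrix.smul_mul, ← hND, transpose_mul, hD, diagonal_transpose]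
        simp only [Matrix.mul_assoc]
    _ = ∏ i, (1 - C (spectralWeight A i) * X) := by
        rw [charpolyRev_smul_eq_prod (charpoly_transpose_mul_self A)]
        simp only [spectralWeight, sum_sq_singularValues_eq_sum_sq_norm_col, ← hs, div_eq_inv_mul]

theorem srankFour_eq_inv_sum_spectralWeight_sq :
    srankFour A = (∑ i, spectralWeight A i ^ 2)⁻¹ := by
  rw [srankFour, Finset.sum_range, Finset.sum_range]
  simp only [spectralWeight, div_pow, ← Finset.sum_div, inv_div, ← pow_mul]

theorem floor_mul_sum_spectralWeight_sq_le {c : ℝ} (hc : 0 ≤ c) :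
    ⌊c * srankFour A⌋₊ * ∑ i, spectralWeight A i ^ 2 ≤ c := by
  have : 0 ≤ ∑ i, spectralWeight A i ^ 2 := Finset.sum_nonneg fun i _ => sq_nonneg _
  rw [srankFour_eq_inv_sum_spectralWeight_sq]
  calc (⌊c * (∑ i, spectralWeight A i ^ 2)⁻¹⌋₊ : ℝ) * ∑ i, spectralWeight A i ^ 2
      ≤ c * (∑ i, spectralWeight A i ^ 2)⁻¹ * ∑ i, spectralWeight A i ^ 2 := by
        gcongr
        exact Nat.floor_le (by positivity)
    _ ≤ c := by
        rw [mul_assoc]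
        exact mul_le_of_le_one_right hc inv_mul_le_one

variable {A}

theorem sum_sq_norm_col_ne_zero (hA : A ≠ 0) : ∑ j, ‖WithLp.toLp 2 (A.col j)‖ ^ 2 ≠ 0 := by
  contrapose! hA
  rw [Finset.sum_eq_zero_iff_of_nonneg fun j _ => sq_nonneg _] at hA
  have hcol (j : Fin m) : A.col j = 0 := by simpa using hA j (Finset.mem_univ j)
  exact ext_col hcol

theorem sum_columnWeight (hA : A ≠ 0) : ∑ j, columnWeight A j = 1 := by
  simp only [columnWeight]
  rw [← Finset.sum_div, div_self (sum_sq_norm_col_ne_zero hA)]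

theorem sum_spectralWeight (hA : A ≠ 0) : ∑ i, spectralWeight A i = 1 := by
  simp only [spectralWeight]
  rw [← Finset.sum_div, sum_sq_singularValues_eq_sum_sq_norm_col,
    div_self (sum_sq_norm_col_ne_zero hA)]

end Weights

theorem corollary1p4 {n m : ℕ} (A : Matrix (Fin n) (Fin m) ℝ) (hA : A ≠ 0)
    (ε : ℝ) (hε₀ : 0 < ε) (hε₁ : ε < 1) :
    ∃ S : Finset (Fin m), S.card = ⌊(1 - ε) ^ 2 * srankFour A⌋₊ + 1 ∧
      ε ≤ sigmaMin (colsSubmatrix (normalizeCols A) S) := by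
  have hgram : ((normalizeCols A)ᵀ * normalizeCols A).PosSemidef := by
    simpa using posSemidef_conjTranspose_mul_self (normalizeCols A)
  have hpos (x : ℝ) (hx : x ≤ ε ^ 2) :
      0 < (expectedMinorPoly ((normalizeCols A)ᵀ * normalizeCols A) (columnWeight A)
        (⌊(1 - ε) ^ 2 * srankFour A⌋₊ + 1) Fin.elim0).eval x :=
    eval_expectedMinorPoly_pos_of_charpolyRev (sum_columnWeight hA)
      (charpolyRev_columnWeight_mul_gram A) (spectralWeight_nonneg A)
      (sum_spectralWeight hA) hε₀ hε₁
      (floor_mul_sum_spectralWeight_sq_le A (sq_nonneg _)) _ hx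
  obtain ⟨g, hg⟩ := exists_forall_det_submatrix_sub_pos hgram (columnWeight_nonneg A)
    (sum_columnWeight hA) (add_zero _).symm hpos
  exact exists_card_eq_le_sigmaMin_colsSubmatrix _ hg
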